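/- Let $p\ge 2$, $m\ge 1$ be integers and let $\theta_1,\theta_2>1$, $\sigma_0>0$, $L\ge 3$, $\kappa_{\rm high}\ge 0$, $\kappa_p,\Delta,G_0,B_0\in\mathbb{R}$. There is a constant $C>0$, depending only on these quantities, such that the following holds for every $n$, every $f:\mathbb{R}^n\to\mathbb{R}$ and every $x_0\in\mathbb{R}^n$ with the properties below. Norms of vectors are Euclidean, norms of tensors are $\|T\|=\max_{\|s_1\|=\dots=\|s_p\|=1}|T[s_1,\dots,s_p]|$, and $\lambda_{\min}$ is the leftmost eigenvalue. **Assumptions.** 1. $f$ is $p$ times continuously differentiable. 2. $f\ge f_{\rm low}$ on $\mathbb{R}^n$, for some $f_{\rm low}\in\mathbb{R}$. 3. $\|\nabla^p f(x)-\nabla^p f(y)\|\le L\|x-y\|$ for all $x,y$. 4. $\min_{\|d\|\le 1}\nabla^i f(x)[d]^i\ge-\kappa_{\rm high}$ for all $x$ and all $i$ with $3\le i\le p-1$. 5. If $p\ge 3$, then $\|\nabla^p f(x)\|\le\kappa_p$ for all $x$. At the starting point, $f(x_0)-f_{\rm low}\le\Delta$, $\|\nabla f(x_0)\|\le G_0$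 and $-\lambda_{\min}(\nabla^2 f(x_0))\le B_0$. **Algorithm ARp-Lazy** (started at $x_0$, $\sigma_0$). For $k=0,1,2,\dots$: - set $T_k=\nabla^p f(x_k)$ if $m$ divides $k$, and $T_k=T_{k-1}$ otherwise; - with $\overline{T}_k(s)=f(x_k)+\sum_{i=1}^{p-1}\frac1{i!}\nabla^i f(x_k)[s]^i+\frac1{p!}T_k[s]^p$ and $m_k(s)=\overline{T}_k(s)+\frac{\sigma_k}{(p+1)!}\|s\|^{p+1}$, choose any step $s_k$ such that $$m_k(s_k)\le m_k(0),\qquad \|\nabla\overline{T}_k(s_k)\|\le\frac{\theta_1\sigma_k\|s_k\|^p}{p!},\qquad \max[0,-\lambda_{\min}(\nabla^2\overline{T}_k(s_k))]\le\frac{\theta_2\sigma_k\|s_k\|^{p-1}}{(p-1)!};$$ - set $x_{k+1}=x_k+s_k$ and $\sigma_{k+1}=\sigma_k+\sigma_k\|s_k\|^{p+1}$. Each iteration evaluates $\nabla^i f(x_k)$ for $1\le i\le p-1$, and also $\nabla^p f(x_k)$ if $m$ divides $k$. **Conclusion.** For every run of the algorithm and all $\epsilon_1,\epsilon_2>0$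 there is a $k\ge 0$ such that $$\|\nabla f(x_k)\|\le\epsilon_1\quad\text{and}\quad\lambda_{\min}(\nabla^2 f(x_k))\ge-\epsilon_2,$$ and both the number $k$ of iterations that produce $x_k$ and the total number of evaluations of the derivatives $\nabla^i f$, $1\le i\le p$, made in these $k$ iterations are at most $$C\,\max\left[\epsilon_1^{-(p+1)/p},\ \epsilon_2^{-(p+1)/(p-1)}\right].$$ -/

import Mathlib

open scoped Nat

noncomputable section

/-- The Hessian matrix of `F` at `x`, with entries `∇²F(x)[eᵢ, eⱼ]`. -/
def hessianMatrix {n : ℕ} (F : EuclideanSpace ℝ (Fin n) → ℝ) (x : EuclideanSpace ℝ (Fin n)) :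
    Matrix (Fin n) (Fin n) ℝ :=
  Matrix.of fun i j =>
    iteratedFDeriv ℝ 2 F x ![EuclideanSpace.single i 1, EuclideanSpace.single j 1]

/-- The leftmost eigenvalue of a real (symmetric) matrix. -/
def lambdaMin {n : ℕ} (A : Matrix (Fin n) (Fin n) ℝ) : ℝ :=
  sInf (spectrum ℝ A)

/-- The Taylor polynomial of order `p` of `f` at `x`, as a function of the displacement `s`,
with the `p`th derivative replaced by the tensor `T`. -/
def approxTaylor {n : ℕ} (p : ℕ) (f : EuclideanSpace ℝ (Fin n) → ℝ)
    (x : EuclideanSpace ℝ (Fin n))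
    (T : ContinuousMultilinearMap ℝ (fun _ : Fin p => EuclideanSpace ℝ (Fin n)) ℝ)
    (s : EuclideanSpace ℝ (Fin n)) : ℝ :=
  f x + ∑ i ∈ Finset.Icc 1 (p - 1), (1 / (i ! : ℝ)) * iteratedFDeriv ℝ i f x (fun _ => s)
    + (1 / (p ! : ℝ)) * T (fun _ => s)

/-- The regularized model `m(s)`. -/
def regModel {n : ℕ} (p : ℕ) (f : EuclideanSpace ℝ (Fin n) → ℝ)
    (x : EuclideanSpace ℝ (Fin n))
    (T : ContinuousMultilinearMap ℝ (fun _ : Fin p => EuclideanSpace ℝ (Fin n)) ℝ)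
    (σ : ℝ) (s : EuclideanSpace ℝ (Fin n)) : ℝ :=
  approxTaylor p f x T s + σ / ((p + 1)! : ℝ) * ‖s‖ ^ (p + 1)

/-- `(x, s, σ, T)` are the iterates, steps, regularization parameters and `p`th order tensors
of a run of ARp-Lazy on `f` from `x₀` with parameters `σ₀`, `θ₁`, `θ₂` and refresh period `m`.
Any steps that pass the three step tests are allowed. -/
structure IsARpLazyRun {n : ℕ} (p m : ℕ) (θ₁ θ₂ σ₀ : ℝ)
    (f : EuclideanSpace ℝ (Fin n) → ℝ) (x₀ : EuclideanSpace ℝ (Fin n))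
    (x s : ℕ → EuclideanSpace ℝ (Fin n)) (σ : ℕ → ℝ)
    (T : ℕ → ContinuousMultilinearMap ℝ (fun _ : Fin p => EuclideanSpace ℝ (Fin n)) ℝ) :
    Prop where
  x_zero : x 0 = x₀
  sigma_zero : σ 0 = σ₀
  /-- every `m` iterations the exact `p`th derivative is computed -/
  tensor_refresh : ∀ k, k % m = 0 → T k = iteratedFDeriv ℝ p f (x k)
  /-- in between the tensor is kept -/
  tensor_keep : ∀ k, (k + 1) % m ≠ 0 → T (k + 1) = T k
  model_decrease : ∀ k,
    regModel p f (x k) (T k) (σ k) (s k) - regModel p f (x k) (T k) (σ k) 0 ≤ 0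
  gradient_test : ∀ k,
    ‖gradient (approxTaylor p f (x k) (T k)) (s k)‖ ≤ θ₁ * σ k * ‖s k‖ ^ p / (p ! : ℝ)
  curvature_test : ∀ k,
    max 0 (-lambdaMin (hessianMatrix (approxTaylor p f (x k) (T k)) (s k))) ≤
      θ₂ * σ k * ‖s k‖ ^ (p - 1) / ((p - 1)! : ℝ)
  x_succ : ∀ k, x (k + 1) = x k + s k
  sigma_succ : ∀ k, σ (k + 1) = σ k + σ k * ‖s k‖ ^ (p + 1)

/-- The derivative evaluations made by ARp-Lazy in iterations `0, …, K - 1`: the pair `(i, j)`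
stands for the evaluation of `∇ⁱf` at `xⱼ` in iteration `j`. Derivatives of orders
`1, …, p - 1` are evaluated in every iteration, the `p`th one only when `m` divides `j`. -/
def lazyEvaluations (p m K : ℕ) : Finset (ℕ × ℕ) :=
  (Finset.Icc 1 p ×ˢ Finset.range K).filter fun c => c.1 < p ∨ c.2 % m = 0

end

/-! The error of the lazy tensor at iteration `k` is at most `L` times the length of the path
travelled since the last refresh. With the current step, this path lies in a window of at most `m`
steps; let `w` be their total length. Taylor expansion then bounds the errors of the model's value,
gradient and Hessian at `s k` by `L * w` times powers of `‖s k‖`. Summed over `k`, the powers `w ^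
(p + 1)` cost at most `m ^ (p + 1)` times the sum of the `‖s k‖ ^ (p + 1)`. The rest concerns real
sequences only. In `exists_regularization_bound`, the sum of `σ k * ‖s k‖ ^ (p + 1)` telescopes to
`σ K - σ₀`. Once `σ` exceeds a threshold `τ`, the model decrease pays for twice the accumulated
Taylor error. Below `τ`, all earlier steps are bounded, hence so are the gradient and curvature,
hence so is the next step (`step_le`), and `σ` cannot jump far past `τ`. So `σ` is bounded by a
constant `S`. In `exists_iteration_bound`, the boundedness of `σ` makes the sum of the `‖s k‖ ^ (p +
1)` bounded. If the new iterate is not approximately optimal, the step tests force `w ^ (p + 1)` to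
be at least a constant times the inverse of the claimed rate. This can happen only as often as the
bounded sum permits. -/

/-! ### Sums over sliding windows and elementary inequalities. -/

open Finset in
/-- Sums over sliding windows of length at most `m` count each index at most `m` times. -/
theorem sum_window_le (u : ℕ → ℝ) (hu : ∀ k, 0 ≤ u k) (m K : ℕ) :
    ∑ k ∈ range K, ∑ i ∈ Ico (k + 1 - m) (k + 1), u i ≤ m * ∑ i ∈ range K, u i := by
  have h : ∑ k ∈ range K, ∑ i ∈ Ico (k + 1 - m) (k + 1), u i
      = ∑ i ∈ range K, ∑ k ∈ Ico i (min K (i + m)), u i := by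
    apply sum_comm'
    intro x y
    simp only [mem_range, mem_Ico]
    omega
  rw [h, mul_sum]
  apply sum_le_sum
  intro i _
  rw [sum_const, nsmul_eq_mul, Nat.card_Ico]
  apply mul_le_mul_of_nonneg_right _ (hu i)
  exact_mod_cast (by omega : min K (i + m) - i ≤ m)

open Finset in
/-- Power mean inequality over a sliding window of length at most `m`. -/
theorem window_pow_le (a : ℕ → ℝ) (ha : ∀ k, 0 ≤ a k) (m p k : ℕ) (hm : 1 ≤ m) :
    (∑ i ∈ Ico (k + 1 - m) (k + 1), a i) ^ (p + 1)
      ≤ m ^ p * ∑ i ∈ Ico (k + 1 - m) (k + 1), a i ^ (p + 1) := by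
  have hs : 0 ≤ ∑ i ∈ Ico (k + 1 - m) (k + 1), a i ^ (p + 1) :=
    sum_nonneg fun i _ => pow_nonneg (ha i) _
  have hc : 0 < (#(Ico (k + 1 - m) (k + 1)) : ℝ) := by
    rw [Nat.card_Ico]; exact_mod_cast (by omega)
  have hcm : (#(Ico (k + 1 - m) (k + 1)) : ℝ) ≤ m := by
    rw [Nat.card_Ico]; exact_mod_cast (by omega)
  have h := pow_sum_div_card_le_sum_pow (s := Ico (k + 1 - m) (k + 1)) (f := a)
    (fun i _ => ha i) p
  rw [div_le_iff₀ (by positivity)] at h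
  calc _ ≤ _ := h
    _ = (#(Ico (k + 1 - m) (k + 1)) : ℝ) ^ p * ∑ i ∈ Ico (k + 1 - m) (k + 1), a i ^ (p + 1) :=
      mul_comm _ _
    _ ≤ _ := by gcongr

-- One factor `m ^ p` comes from the power mean inequality in each window, another `m` from the
-- overlap of windows.
open Finset in
theorem sum_window_pow_le (a : ℕ → ℝ) (ha : ∀ k, 0 ≤ a k) (m p : ℕ) (hm : 1 ≤ m) (K : ℕ) :
    ∑ k ∈ range K, (∑ i ∈ Ico (k + 1 - m) (k + 1), a i) ^ (p + 1)
      ≤ (m : ℝ) ^ (p + 1) * ∑ k ∈ range K, a k ^ (p + 1) := by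
  calc _ ≤ ∑ k ∈ range K, (m : ℝ) ^ p * ∑ i ∈ Ico (k + 1 - m) (k + 1), a i ^ (p + 1) :=
        sum_le_sum fun k _ => window_pow_le a ha m p k hm
    _ ≤ (m : ℝ) ^ p * (m * ∑ k ∈ range K, a k ^ (p + 1)) := by
        rw [← mul_sum]
        exact mul_le_mul_of_nonneg_left
          (sum_window_le (fun i => a i ^ (p + 1)) (fun i => pow_nonneg (ha i) _) m K)
          (by positivity)
    _ = _ := by ring

/-- A number whose `r`th power dominates `ε` up to a factor has a large `t`th power. -/
theorem one_le_mul_rpow_mul_pow {c ε w : ℝ} (hc : 1 ≤ c) (hε : 0 < ε) (hw : 0 ≤ w) {r t : ℕ}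
    (hr : 0 < r) (htr : t ≤ 3 * r) (h : ε ≤ c * w ^ r) {q : ℝ} (hq : q = t / r) :
    1 ≤ c ^ 3 * ε ^ (-q) * w ^ t := by
  have hr' : (0 : ℝ) < r := by exact_mod_cast hr
  have hq0 : 0 ≤ q := by rw [hq]; positivity
  -- The exponents used are `(p + 1) / p` and `(p + 1) / (p - 1)`, both at most 3 for `p ≥ 2`.
  have hq3 : q ≤ 3 := by
    rw [hq, div_le_iff₀ hr']; exact_mod_cast htr
  have h1 : ε ^ q ≤ c ^ q * w ^ t := by
    calc ε ^ q ≤ (c * w ^ r) ^ q := Real.rpow_le_rpow hε.le h hq0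
      _ = c ^ q * (w ^ r) ^ q := Real.mul_rpow (by linarith) (by positivity)
      _ = c ^ q * w ^ t := by
        congr 1
        rw [← Real.rpow_natCast w r, ← Real.rpow_mul hw, ← Real.rpow_natCast w t]
        congr 1
        rw [hq]; field_simp
  have h2 : c ^ q ≤ c ^ 3 := by
    rw [← Real.rpow_natCast c 3]
    exact Real.rpow_le_rpow_of_exponent_le hc (by exact_mod_cast hq3)
  have h3 : 0 < ε ^ q := Real.rpow_pos_of_pos hε q
  rw [Real.rpow_neg hε.le]
  have h4 : ε ^ q ≤ c ^ 3 * w ^ t := h1.trans (by gcongr)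
  calc (1 : ℝ) ≤ (c ^ 3 * w ^ t) / ε ^ q := by rwa [one_le_div h3]
    _ = _ := by ring

theorem le_of_pow_le_of_one_le {a ρ : ℝ} (hρ : 1 ≤ ρ) {t : ℕ} (ht : t ≠ 0)
    (h : a ^ t ≤ ρ) : a ≤ ρ := by
  rcases le_total a 1 with h1 | h1
  · linarith
  · exact (le_self_pow₀ h1 ht).trans h

open Finset in
/-- A number whose `(p+1)`st power is dominated by its lower powers is bounded. -/
theorem le_of_mul_pow_le_sum_pow {a α A : ℝ} {p : ℕ} (hα : 0 < α) (hA : 0 ≤ A)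
    (h : α * a ^ (p + 1) ≤ A * ∑ i ∈ Icc 1 p, a ^ i) : a ≤ max 1 (A * p / α) := by
  rcases le_total a 1 with h1 | h1
  · exact le_max_of_le_left h1
  · apply le_max_of_le_right
    have h2 : ∑ i ∈ Icc 1 p, a ^ i ≤ p * a ^ p := by
      calc ∑ i ∈ Icc 1 p, a ^ i ≤ ∑ i ∈ Icc 1 p, a ^ p := by
            apply sum_le_sum
            intro i hi
            exact pow_le_pow_right₀ h1 (mem_Icc.1 hi).2
        _ = p * a ^ p := by simp
    have h3 : 0 < a ^ p := by positivity
    rw [le_div_iff₀ hα]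
    have h4 : α * a ^ (p + 1) ≤ A * (p * a ^ p) := h.trans (by gcongr)
    have h5 : (a * α) * a ^ p ≤ (A * p) * a ^ p := by
      calc (a * α) * a ^ p = α * a ^ (p + 1) := by ring
        _ ≤ _ := h4
        _ = _ := by ring
    exact le_of_mul_le_mul_right h5 h3

/-! ### Complexity analysis for abstract real sequences. -/

open Finset in
/-- Abstract analysis of a method whose steps have lengths `a k` and whose regularization
parameters are `σ (k + 1) = σ k + σ k * a k ^ (p + 1)`: the parameters remain bounded. -/
theorem exists_regularization_bound (p m : ℕ) (hp : 2 ≤ p) (hm : 1 ≤ m)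
    (θ σ₀ L κ N Δ G₀ B₀ : ℝ) (hθ : 0 ≤ θ) (hσ₀ : 0 < σ₀) (hL : 0 < L) (hκ : 0 ≤ κ) (hN : 0 < N) :
    ∃ S : ℝ, σ₀ ≤ S ∧ ∀ (a σ F G B : ℕ → ℝ) (flow : ℝ),
      (∀ k, 0 ≤ a k) → σ 0 = σ₀ → (∀ k, σ (k + 1) = σ k + σ k * a k ^ (p + 1)) →
      (∀ k, flow ≤ F k) → F 0 - flow ≤ Δ → G 0 ≤ G₀ → B 0 ≤ B₀ →
      (∀ k, F (k + 1) ≤ F k - σ k / N * a k ^ (p + 1)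
        + L * (∑ i ∈ Ico (k + 1 - m) (k + 1), a i) * a k ^ p) →
      (∀ k, G (k + 1) ≤ θ * σ k * a k ^ p
        + L * (∑ i ∈ Ico (k + 1 - m) (k + 1), a i) * a k ^ (p - 1)) →
      (∀ k, B (k + 1) ≤ θ * σ k * a k ^ (p - 1)
        + L * (∑ i ∈ Ico (k + 1 - m) (k + 1), a i) * a k ^ (p - 2)) →
      (∀ k, σ k / N * a k ^ (p + 1) ≤ (max (G k) 0 + max (B k) 0 + κ
        + L * ∑ i ∈ Ico (k + 1 - m) k, a i) * ∑ i ∈ Icc 1 p, a k ^ i) →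
      (∀ k, σ₀ ≤ σ k) ∧ (∀ k, σ k ≤ S) := by
  have hm' : (1 : ℝ) ≤ m := by exact_mod_cast hm
  -- The total Taylor error is at most `c` times the sum of the `a k ^ (p + 1)`. The choice of `τ`
  -- gives `c / τ = 1 / (2 * N)`, half the rate of the model decrease.
  obtain ⟨c, hc⟩ : ∃ c : ℝ, c = L * (m : ℝ) ^ (p + 1) := ⟨_, rfl⟩
  have hc0 : 0 < c := by rw [hc]; positivity
  obtain ⟨τ, hτ⟩ : ∃ τ : ℝ, τ = 2 * N * c := ⟨_, rfl⟩
  have hτ0 : 0 < τ := by rw [hτ]; positivity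
  -- While `σ k < τ`: `r` bounds the earlier steps, `g` bounds `G k` and `B k` for `k ≥ 1`, `R`
  -- bounds `a k`, and `t` bounds `σ (k + 1)`.
  obtain ⟨r, hr⟩ : ∃ r : ℝ, r = max 1 (τ / σ₀) := ⟨_, rfl⟩
  have hr1 : 1 ≤ r := hr ▸ le_max_left _ _
  obtain ⟨g, hg⟩ : ∃ g : ℝ, g = (θ * τ + L * (m * r)) * r ^ p := ⟨_, rfl⟩
  have hg0 : 0 ≤ g := by rw [hg]; positivity
  obtain ⟨A, hA⟩ : ∃ A : ℝ, A = max g |G₀| + max g |B₀| + κ + L * (m * r) := ⟨_, rfl⟩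
  have hA0 : 0 ≤ A := by rw [hA]; positivity
  obtain ⟨R, hR⟩ : ∃ R : ℝ, R = max 1 (A * p / (σ₀ / N)) := ⟨_, rfl⟩
  have hR1 : 1 ≤ R := hR ▸ le_max_left _ _
  obtain ⟨t, ht⟩ : ∃ t : ℝ, t = τ + τ * R ^ (p + 1) := ⟨_, rfl⟩
  have ht0 : 0 < t := by rw [ht]; positivity
  refine ⟨max σ₀ (2 * N * (Δ + c * t / σ₀ + σ₀ / N)), le_max_left _ _, ?_⟩
  intro a σ F G B flow ha hσz hσs hF hΔ hG0 hB0 hdesc hG hB hstep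
  have hσpos : ∀ k, σ₀ ≤ σ k := by
    intro k
    induction k with
    | zero => exact hσz.ge
    | succ k ih =>
      rw [hσs]
      have : 0 ≤ σ k * a k ^ (p + 1) := mul_nonneg (hσ₀.le.trans ih) (pow_nonneg (ha k) _)
      linarith
  have hσ0 : ∀ k, 0 < σ k := fun k => hσ₀.trans_le (hσpos k)
  have hmono : Monotone σ := by
    apply monotone_nat_of_le_succ
    intro k
    rw [hσs]
    have : 0 ≤ σ k * a k ^ (p + 1) := mul_nonneg (hσ0 k).le (pow_nonneg (ha k) _)
    linarith
  refine ⟨hσpos, ?_⟩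
  have hσsum : ∀ K, σ K = σ₀ + ∑ k ∈ range K, σ k * a k ^ (p + 1) := by
    intro K
    induction K with
    | zero => simp [hσz]
    | succ K ih => rw [sum_range_succ, hσs, ← add_assoc, ← ih]
  -- accumulated descent
  have hFsum : ∀ K, F K ≤ F 0 - (∑ k ∈ range K, σ k * a k ^ (p + 1)) / N
      + L * ∑ k ∈ range K, (∑ i ∈ Ico (k + 1 - m) (k + 1), a i) ^ (p + 1) := by
    intro K
    induction K with
    | zero => simp
    | succ K ih =>
      rw [sum_range_succ, sum_range_succ, add_div, mul_add]
      have hw : a K ≤ ∑ i ∈ Ico (K + 1 - m) (K + 1), a i :=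
        single_le_sum (fun i _ => ha i) (by rw [mem_Ico]; omega)
      have h0 := (ha K).trans hw
      have h1 : L * (∑ i ∈ Ico (K + 1 - m) (K + 1), a i) * a K ^ p
          ≤ L * (∑ i ∈ Ico (K + 1 - m) (K + 1), a i) ^ (p + 1) := by
        rw [pow_succ', ← mul_assoc]
        exact mul_le_mul_of_nonneg_left (pow_le_pow_left₀ (ha K) hw _) (by positivity)
      have h2 := hdesc K
      have h3 : σ K / N * a K ^ (p + 1) = σ K * a K ^ (p + 1) / N := by ring
      linarith
  have hwin := sum_window_pow_le a ha m p hm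
  -- steps are bounded as long as the regularization parameter is small
  have hbound : ∀ k, σ k < τ → a k ≤ R := by
    intro k hk
    have hprev : ∀ i, i < k → a i ≤ r := by
      intro i hi
      -- An earlier long step would already have lifted `σ`: `σ₀ * a i ^ (p + 1) ≤ σ (i + 1) ≤ σ k <
      -- τ`.
      apply le_of_pow_le_of_one_le hr1 (t := p + 1) (by omega)
      rw [hr]
      apply le_max_of_le_right
      rw [le_div_iff₀ hσ₀]
      have h1 : σ (i + 1) ≤ σ k := hmono hi
      rw [hσs] at h1
      have h2 : a i ^ (p + 1) * σ₀ ≤ a i ^ (p + 1) * σ i :=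
        mul_le_mul_of_nonneg_left (hσpos i) (pow_nonneg (ha i) _)
      have := hσ0 i
      linarith
    have hwprev : ∀ u v, v ≤ k → v - u ≤ m → ∑ i ∈ Ico u v, a i ≤ m * r := by
      intro u v hv huv
      calc ∑ i ∈ Ico u v, a i ≤ ∑ i ∈ Ico u v, r :=
            sum_le_sum fun i hi => hprev i (by rw [mem_Ico] at hi; omega)
        _ = ((v - u : ℕ) : ℝ) * r := by rw [sum_const, nsmul_eq_mul, Nat.card_Ico]
        _ ≤ m * r := by
            apply mul_le_mul_of_nonneg_right _ (by linarith)
            exact_mod_cast huv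
    have hterm : ∀ j, j + 1 = k → ∀ u v : ℕ, u ≤ p → v ≤ p → θ * σ j * a j ^ u
        + L * (∑ i ∈ Ico (j + 1 - m) (j + 1), a i) * a j ^ v ≤ g := by
      intro j hj u v hu hv
      have hpow : ∀ u, u ≤ p → a j ^ u ≤ r ^ p := fun u hu =>
        (pow_le_pow_left₀ (ha j) (hprev j (by omega)) u).trans (pow_le_pow_right₀ hr1 hu)
      have h1 : σ j ≤ τ := (hmono (by omega : j ≤ k)).trans hk.le
      have h2 := hwprev (j + 1 - m) (j + 1) (by omega) (by omega)
      rw [hg, add_mul]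
      apply add_le_add
      · exact mul_le_mul (mul_le_mul_of_nonneg_left h1 hθ) (hpow u hu) (pow_nonneg (ha j) _)
          (by positivity)
      · exact mul_le_mul (mul_le_mul_of_nonneg_left h2 hL.le) (hpow v hv) (pow_nonneg (ha j) _)
          (by positivity)
    have hGk : max (G k) 0 ≤ max g |G₀| := by
      apply max_le _ (le_max_of_le_left hg0)
      rcases k with _ | j
      · exact le_max_of_le_right (hG0.trans (le_abs_self _))
      · exact le_max_of_le_left ((hG j).trans (hterm j rfl _ _ (by omega) (by omega)))
    have hBk : max (B k) 0 ≤ max g |B₀| := by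
      apply max_le _ (le_max_of_le_left hg0)
      rcases k with _ | j
      · exact le_max_of_le_right (hB0.trans (le_abs_self _))
      · exact le_max_of_le_left ((hB j).trans (hterm j rfl _ _ (by omega) (by omega)))
    rw [hR]
    apply le_of_mul_pow_le_sum_pow (by positivity) hA0
    have hs : 0 ≤ ∑ i ∈ Icc 1 p, a k ^ i := sum_nonneg fun i _ => pow_nonneg (ha k) _
    calc σ₀ / N * a k ^ (p + 1) ≤ σ k / N * a k ^ (p + 1) := by
          apply mul_le_mul_of_nonneg_right _ (pow_nonneg (ha k) _)
          exact div_le_div_of_nonneg_right (hσpos k) hN.le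
      _ ≤ _ := hstep k
      _ ≤ A * ∑ i ∈ Icc 1 p, a k ^ i := by
          apply mul_le_mul_of_nonneg_right _ hs
          have := mul_le_mul_of_nonneg_left (hwprev (k + 1 - m) k le_rfl (by omega)) hL.le
          rw [hA]
          linarith
  have hasum : ∀ K, ∑ k ∈ range K, a k ^ (p + 1) ≤ σ K / σ₀ := by
    intro K
    rw [le_div_iff₀ hσ₀, sum_mul, hσsum K]
    have : ∑ k ∈ range K, a k ^ (p + 1) * σ₀ ≤ ∑ k ∈ range K, σ k * a k ^ (p + 1) := by
      apply sum_le_sum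
      intro k _
      rw [mul_comm]
      exact mul_le_mul_of_nonneg_right (hσpos k) (pow_nonneg (ha k) _)
    linarith
  -- Steps made while `σ < τ` contribute at most `t / σ₀` altogether; each later one is at most the
  -- increase of `σ` divided by `τ`.
  have hasum' : ∀ K, ∑ k ∈ range K, a k ^ (p + 1) ≤ t / σ₀ + σ K / τ := by
    intro K
    induction K with
    | zero => simp only [range_zero, sum_empty]; have := hσ0 0; positivity
    | succ K ih =>
      rcases lt_or_ge (σ K) τ with h | h
      · have h1 := hasum (K + 1)
        have h2 : σ (K + 1) ≤ t := by
          rw [hσs, ht]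
          have := hbound K h
          have h3 : a K ^ (p + 1) ≤ R ^ (p + 1) := pow_le_pow_left₀ (ha K) this _
          have h4 : σ K * a K ^ (p + 1) ≤ τ * R ^ (p + 1) :=
            mul_le_mul h.le h3 (pow_nonneg (ha K) _) hτ0.le
          linarith
        have h3 : σ (K + 1) / σ₀ ≤ t / σ₀ := div_le_div_of_nonneg_right h2 hσ₀.le
        have h4 : 0 < σ (K + 1) / τ := div_pos (hσ0 _) hτ0
        linarith
      · rw [sum_range_succ, hσs, add_div]
        have : a K ^ (p + 1) ≤ σ K * a K ^ (p + 1) / τ := by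
          rw [le_div_iff₀ hτ0, mul_comm]
          exact mul_le_mul_of_nonneg_right h (pow_nonneg (ha K) _)
        linarith
  intro K
  apply le_max_of_le_right
  have h1 := hFsum K
  have h2 := hF K
  have h3 : L * ∑ k ∈ range K, (∑ i ∈ Ico (k + 1 - m) (k + 1), a i) ^ (p + 1)
      ≤ c * (t / σ₀ + σ K / τ) := by
    calc _ ≤ L * ((m : ℝ) ^ (p + 1) * ∑ k ∈ range K, a k ^ (p + 1)) :=
          mul_le_mul_of_nonneg_left (hwin K) hL.le
      _ = c * ∑ k ∈ range K, a k ^ (p + 1) := by rw [hc]; ring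
      _ ≤ _ := mul_le_mul_of_nonneg_left (hasum' K) hc0.le
  have h4 : ∑ k ∈ range K, σ k * a k ^ (p + 1) = σ K - σ₀ := by rw [hσsum K]; ring
  -- The last term is absorbed by `σ K / N` in the accumulated descent, which leaves a bound on `σ
  -- K`.
  have h5 : c * (t / σ₀ + σ K / τ) = c * t / σ₀ + σ K / N / 2 := by
    rw [hτ]; field_simp
  rw [h4, sub_div] at h1
  have h6 : σ K / N ≤ 2 * (Δ + c * t / σ₀ + σ₀ / N) := by linarith
  rw [div_le_iff₀ hN] at h6
  linarith

open Finset in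
/-- Iteration complexity of the abstract method. -/
theorem exists_iteration_bound (p m : ℕ) (hp : 2 ≤ p) (hm : 1 ≤ m)
    (θ σ₀ L κ N Δ G₀ B₀ : ℝ) (hθ : 0 ≤ θ) (hσ₀ : 0 < σ₀) (hL : 0 < L) (hκ : 0 ≤ κ) (hN : 0 < N) :
    ∃ C : ℝ, 0 < C ∧ ∀ (a σ F G B : ℕ → ℝ) (flow : ℝ),
      (∀ k, 0 ≤ a k) → σ 0 = σ₀ → (∀ k, σ (k + 1) = σ k + σ k * a k ^ (p + 1)) →
      (∀ k, flow ≤ F k) → F 0 - flow ≤ Δ → G 0 ≤ G₀ → B 0 ≤ B₀ →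
      (∀ k, F (k + 1) ≤ F k - σ k / N * a k ^ (p + 1)
        + L * (∑ i ∈ Ico (k + 1 - m) (k + 1), a i) * a k ^ p) →
      (∀ k, G (k + 1) ≤ θ * σ k * a k ^ p
        + L * (∑ i ∈ Ico (k + 1 - m) (k + 1), a i) * a k ^ (p - 1)) →
      (∀ k, B (k + 1) ≤ θ * σ k * a k ^ (p - 1)
        + L * (∑ i ∈ Ico (k + 1 - m) (k + 1), a i) * a k ^ (p - 2)) →
      (∀ k, σ k / N * a k ^ (p + 1) ≤ (max (G k) 0 + max (B k) 0 + κ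
        + L * ∑ i ∈ Ico (k + 1 - m) k, a i) * ∑ i ∈ Icc 1 p, a k ^ i) →
      ∀ ε₁ ε₂ : ℝ, 0 < ε₁ → 0 < ε₂ → ∃ k : ℕ, G k ≤ ε₁ ∧ B k ≤ ε₂ ∧
        (k : ℝ) ≤ C * max (ε₁ ^ (-(((p : ℝ) + 1) / p))) (ε₂ ^ (-(((p : ℝ) + 1) / ((p : ℝ) - 1)))) := by
  obtain ⟨S, hS0, hS⟩ := exists_regularization_bound p m hp hm θ σ₀ L κ N Δ G₀ B₀ hθ hσ₀ hL hκ hN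
  have hSpos : 0 < S := hσ₀.trans_le hS0
  have hm' : (1 : ℝ) ≤ m := by exact_mod_cast hm
  obtain ⟨c, hc⟩ : ∃ c : ℝ, c = max 1 (θ * S + L) := ⟨_, rfl⟩
  have hc1 : 1 ≤ c := hc ▸ le_max_left _ _
  obtain ⟨D, hD⟩ : ∃ D : ℝ, D = c ^ 3 * ((m : ℝ) ^ (p + 1) * (S / σ₀)) := ⟨_, rfl⟩
  have hD0 : 0 < D := by rw [hD]; positivity
  obtain ⟨M, hM⟩ : ∃ M : ℝ, M = (max 1 (max G₀ B₀)) ^ 3 := ⟨_, rfl⟩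
  have hM0 : 0 < M := by rw [hM]; positivity
  refine ⟨D + M, by positivity, ?_⟩
  intro a σ F G B flow ha hσz hσs hF hΔ hG0 hB0 hdesc hG hB hstep ε₁ ε₂ hε₁ hε₂
  obtain ⟨hσl, hσu⟩ := hS a σ F G B flow ha hσz hσs hF hΔ hG0 hB0 hdesc hG hB hstep
  set E : ℝ := max (ε₁ ^ (-(((p : ℝ) + 1) / p))) (ε₂ ^ (-(((p : ℝ) + 1) / ((p : ℝ) - 1)))) with hE
  have hE0 : 0 < E := lt_max_of_lt_left (Real.rpow_pos_of_pos hε₁ _)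
  have hq1 : ((p : ℝ) + 1) / p = ((p + 1 : ℕ) : ℝ) / (p : ℕ) := by push_cast; rfl
  have hq2 : ((p : ℝ) + 1) / ((p : ℝ) - 1) = ((p + 1 : ℕ) : ℝ) / ((p - 1 : ℕ) : ℝ) := by
    rw [Nat.cast_sub (by omega)]; push_cast; rfl
  by_cases hstart : G 0 ≤ ε₁ ∧ B 0 ≤ ε₂
  · exact ⟨0, hstart.1, hstart.2, by simp only [Nat.cast_zero]; positivity⟩
  -- If the starting point fails, one tolerance is below `max G₀ B₀`, so `E` cannot be small. This
  -- gives the slack of one needed for rounding at the end.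
  have hME : 1 ≤ M * E := by
    have key : ∀ ε : ℝ, 0 < ε → ε ≤ max G₀ B₀ → ∀ (r : ℕ), 0 < r → p + 1 ≤ 3 * r →
        ∀ q : ℝ, q = ((p + 1 : ℕ) : ℝ) / r → 1 ≤ M * ε ^ (-q) := by
      intro ε hε h r hr hr3 q hq
      have := one_le_mul_rpow_mul_pow (c := max 1 (max G₀ B₀)) (w := 1) (le_max_left _ _) hε
        zero_le_one hr hr3 (by rw [one_pow, mul_one]; exact le_max_of_le_right h) hq
      rwa [one_pow, mul_one, ← hM] at this
    rw [not_and_or, not_le, not_le] at hstart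
    rcases hstart with h | h
    · exact (key ε₁ hε₁ (le_max_of_le_left (h.le.trans hG0)) p (by omega) (by omega) _ hq1).trans
        (mul_le_mul_of_nonneg_left (le_max_left _ _) hM0.le)
    · exact (key ε₂ hε₂ (le_max_of_le_right (h.le.trans hB0)) (p - 1) (by omega) (by omega) _
        hq2).trans (mul_le_mul_of_nonneg_left (le_max_right _ _) hM0.le)
  by_contra! hcon
  -- A failure at iterate `k + 1` is charged to the window that ends with step `k`.
  have hfail : ∀ k : ℕ, ((k + 1 : ℕ) : ℝ) ≤ (D + M) * E →
      1 ≤ c ^ 3 * E * (∑ i ∈ Ico (k + 1 - m) (k + 1), a i) ^ (p + 1) := by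
    intro k hk
    have hwa : a k ≤ ∑ i ∈ Ico (k + 1 - m) (k + 1), a i :=
      single_le_sum (fun i _ => ha i) (by rw [mem_Ico]; omega)
    set w := ∑ i ∈ Ico (k + 1 - m) (k + 1), a i
    have hw0 : 0 ≤ w := (ha k).trans hwa
    have hle : ∀ u : ℕ, θ * σ k * a k ^ (u + 1) + L * w * a k ^ u ≤ c * w ^ (u + 1) := by
      intro u
      have h1 : θ * σ k * a k ^ (u + 1) ≤ θ * S * w ^ (u + 1) :=
        mul_le_mul (mul_le_mul_of_nonneg_left (hσu k) hθ) (pow_le_pow_left₀ (ha k) hwa _)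
          (pow_nonneg (ha k) _) (by positivity)
      have h2 : L * w * a k ^ u ≤ L * w ^ (u + 1) := by
        rw [pow_succ', ← mul_assoc]
        exact mul_le_mul_of_nonneg_left (pow_le_pow_left₀ (ha k) hwa _) (by positivity)
      calc _ ≤ (θ * S + L) * w ^ (u + 1) := by linarith
        _ ≤ _ := mul_le_mul_of_nonneg_right (hc ▸ le_max_right _ _) (by positivity)
    by_cases hGk : G (k + 1) ≤ ε₁
    · have hBk : ε₂ < B (k + 1) := by
        by_contra! hBk
        exact absurd hk (not_le.2 (hcon (k + 1) hGk hBk))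
      have h1 := hB k
      have h2 := hle (p - 2)
      rw [show p - 2 + 1 = p - 1 by omega] at h2
      have h3 := one_le_mul_rpow_mul_pow (t := p + 1) hc1 hε₂ hw0 (by omega : 0 < p - 1)
        (by omega) (hBk.le.trans (h1.trans h2)) hq2
      refine h3.trans ?_
      gcongr
      exact le_max_right _ _
    · have h1 := hG k
      have h2 := hle (p - 1)
      rw [show p - 1 + 1 = p by omega] at h2
      have h3 := one_le_mul_rpow_mul_pow (t := p + 1) hc1 hε₁ hw0 (by omega : 0 < p)
        (by omega) ((not_le.1 hGk).le.trans (h1.trans h2)) hq1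
      refine h3.trans ?_
      gcongr
      exact le_max_left _ _
  have hasum : ∀ K, ∑ k ∈ range K, a k ^ (p + 1) ≤ (σ K - σ₀) / σ₀ := by
    intro K
    induction K with
    | zero => simp [hσz]
    | succ K ih =>
      rw [sum_range_succ]
      have h1 : a K ^ (p + 1) ≤ σ K * a K ^ (p + 1) / σ₀ := by
        rw [le_div_iff₀ hσ₀, mul_comm]
        exact mul_le_mul_of_nonneg_right (hσl K) (pow_nonneg (ha K) _)
      calc _ ≤ (σ K - σ₀) / σ₀ + σ K * a K ^ (p + 1) / σ₀ := add_le_add ih h1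
        _ = _ := by rw [hσs]; ring
  have hcount : ∀ K : ℕ, (K : ℝ) ≤ (D + M) * E → (K : ℝ) < D * E := by
    intro K hK
    have h1 : (K : ℝ) ≤ c ^ 3 * E *
        ∑ k ∈ range K, (∑ i ∈ Ico (k + 1 - m) (k + 1), a i) ^ (p + 1) := by
      rw [mul_sum]
      calc (K : ℝ) = ∑ k ∈ range K, (1 : ℝ) := by simp
        _ ≤ _ := by
          apply sum_le_sum
          intro k hk
          apply hfail
          refine le_trans ?_ hK
          exact_mod_cast (mem_range.1 hk)
    have h2 : ∑ k ∈ range K, (∑ i ∈ Ico (k + 1 - m) (k + 1), a i) ^ (p + 1)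
        ≤ (m : ℝ) ^ (p + 1) * ∑ k ∈ range K, a k ^ (p + 1) :=
      sum_window_pow_le a ha m p hm K
    have h3 : ∑ k ∈ range K, a k ^ (p + 1) < S / σ₀ := by
      refine (hasum K).trans_lt ?_
      apply div_lt_div_of_pos_right _ hσ₀
      linarith [hσu K]
    calc (K : ℝ) ≤ _ := h1
      _ ≤ c ^ 3 * E * ((m : ℝ) ^ (p + 1) * ∑ k ∈ range K, a k ^ (p + 1)) := by gcongr
      _ < c ^ 3 * E * ((m : ℝ) ^ (p + 1) * (S / σ₀)) := by gcongr
      _ = D * E := by rw [hD]; ring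
  -- For this integer `K`, `D * E + M * E < K + 1 < D * E + 1`, against `1 ≤ M * E`.
  have hK1 : (⌊(D + M) * E⌋₊ : ℝ) ≤ (D + M) * E := Nat.floor_le (by positivity)
  have hK2 := hcount _ hK1
  have hK3 := Nat.lt_floor_add_one ((D + M) * E)
  linarith

/-! ### Symmetry of higher derivatives. -/

section Symmetric

variable {E F : Type*} [NormedAddCommGroup E] [NormedSpace ℝ E] [NormedAddCommGroup F]
  [NormedSpace ℝ F]

theorem fderiv_continuousMultilinearMap_apply {n : ℕ}
    {Φ : E → ContinuousMultilinearMap ℝ (fun _ : Fin n => E) F} {x : E}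
    (hΦ : DifferentiableAt ℝ Φ x) (u : Fin n → E) (z : E) :
    fderiv ℝ Φ x z u = fderiv ℝ (fun y => Φ y u) x z :=
  (congrArg (fun l => l z) ((ContinuousMultilinearMap.apply ℝ (fun _ : Fin n => E) F
    u).hasFDerivAt.comp x hΦ.hasFDerivAt).fderiv).symm

/-- The `n`th derivative of a `C^n` function is symmetric. -/
theorem ContDiff.iteratedFDeriv_comp_perm {f : E → F} : ∀ {n : ℕ}, ContDiff ℝ n f →
    ∀ (x : E) (v : Fin n → E) (σ : Equiv.Perm (Fin n)),
      iteratedFDeriv ℝ n f x (v ∘ σ) = iteratedFDeriv ℝ n f x v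
  | 0, _, x, v, σ => by simp
  | 1, _, x, v, σ => by rw [Subsingleton.elim σ 1]; rfl
  | n + 2, hf, x, v, σ => by
    have hd : Differentiable ℝ (iteratedFDeriv ℝ (n + 1) f) :=
      hf.differentiable_iteratedFDeriv (by exact_mod_cast (by omega : n + 1 < n + 2))
    -- Permutations fixing `0` are handled by differentiating the symmetry of order `n + 1`; the
    -- swap of `0` and `1` is the symmetry of the second derivative of `iteratedFDeriv ℝ n f`.
    -- Together these generate all permutations.
    have hstab : ∀ (w : Fin (n + 2) → E) (τ : Equiv.Perm (Fin (n + 2))), τ 0 = 0 →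
        iteratedFDeriv ℝ (n + 2) f x (w ∘ τ) = iteratedFDeriv ℝ (n + 2) f x w := by
      intro w τ hτ
      obtain ⟨⟨j, ρ⟩, rfl⟩ := Equiv.Perm.decomposeFin.symm.surjective τ
      rw [Equiv.Perm.decomposeFin_symm_apply_zero] at hτ
      subst hτ
      have h1 : Fin.tail (w ∘ Equiv.Perm.decomposeFin.symm (0, ρ)) = Fin.tail w ∘ ρ := by
        funext i
        simp [Fin.tail, Equiv.Perm.decomposeFin_symm_apply_succ]
      rw [iteratedFDeriv_succ_apply_left, iteratedFDeriv_succ_apply_left, h1]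
      have h2 := fun u z => fderiv_continuousMultilinearMap_apply (hd x) u z
      rw [h2, h2]
      have h3 : (fun y => iteratedFDeriv ℝ (n + 1) f y (Fin.tail w ∘ ρ))
          = fun y => iteratedFDeriv ℝ (n + 1) f y (Fin.tail w) := by
        funext y
        exact ContDiff.iteratedFDeriv_comp_perm
          (hf.of_le (by exact_mod_cast (by omega : n + 1 ≤ n + 2))) y _ ρ
      rw [h3]
      simp [Equiv.Perm.decomposeFin_symm_apply_zero]
    have hswap : ∀ w : Fin (n + 2) → E,
        iteratedFDeriv ℝ (n + 2) f x (w ∘ Equiv.swap 0 1) = iteratedFDeriv ℝ (n + 2) f x w := by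
      intro w
      have hsymm : ContDiff ℝ 2 (iteratedFDeriv ℝ n f) :=
        hf.iteratedFDeriv_right (by exact_mod_cast (by omega : 2 + n ≤ n + 2))
      have h1 : ∀ u : Fin (n + 2) → E, iteratedFDeriv ℝ (n + 2) f x u
          = fderiv ℝ (fderiv ℝ (iteratedFDeriv ℝ n f)) x (u 0) (u 1) (fun i => u i.succ.succ) := by
        intro u
        have hd2 : DifferentiableAt ℝ (fderiv ℝ (iteratedFDeriv ℝ n f)) x :=
          (hsymm.fderiv_right (m := 1) (by norm_num)).differentiable (by norm_num) x
        rw [iteratedFDeriv_succ_apply_left, fderiv_continuousMultilinearMap_apply (hd x)]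
        simp only [iteratedFDeriv_succ_apply_left]
        have hΦ : HasFDerivAt (fun y => fderiv ℝ (iteratedFDeriv ℝ n f) y (Fin.tail u 0))
            ((fderiv ℝ (fderiv ℝ (iteratedFDeriv ℝ n f)) x).flip (Fin.tail u 0)) x := by
          simpa using hd2.hasFDerivAt.clm_apply (hasFDerivAt_const (Fin.tail u 0) x)
        rw [← fderiv_continuousMultilinearMap_apply hΦ.differentiableAt, hΦ.fderiv]
        rfl
      rw [h1, h1]
      have h2 := (hsymm.contDiffAt (x := x)).isSymmSndFDerivAt (by simp) (w 0) (w 1)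
      have h4 : (w ∘ Equiv.swap 0 1) 0 = w 1 := by simp
      have h5 : (w ∘ Equiv.swap 0 1) 1 = w 0 := by simp
      have h3 : (fun i : Fin n => (w ∘ Equiv.swap 0 1) i.succ.succ)
          = fun i : Fin n => w i.succ.succ := by
        funext i
        simp only [Function.comp_apply]
        rw [Equiv.swap_apply_of_ne_of_ne (Fin.succ_ne_zero _)]
        intro h
        exact Fin.succ_ne_zero i (Fin.succ_injective _ h)
      rw [h3, h4, h5, h2]
    by_cases h0 : σ 0 = 0
    · exact hstab v σ h0
    · have hfix : Equiv.swap 1 (σ.symm 0) 0 = 0 :=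
        Equiv.swap_apply_of_ne_of_ne (by simp)
          fun h => h0 (by conv_lhs => rw [h, Equiv.apply_symm_apply])
      -- `σ * swap 1 (σ.symm 0) * swap 0 1` sends `0` to `1`, then to `σ.symm 0`, then to `0`.
      rw [← hstab (v ∘ σ) _ hfix, ← hswap]
      exact hstab v (σ * Equiv.swap 1 (σ.symm 0) * Equiv.swap 0 1) (by simp)

end Symmetric

/-! ### Taylor expansion with an inexact top-order tensor. -/

section Taylor

variable {E F : Type} [NormedAddCommGroup E] [NormedSpace ℝ E] [NormedAddCommGroup F]
  [NormedSpace ℝ F]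

/-- The `n`th derivative of a polynomial of degree less than `n` vanishes. -/
theorem HasFiniteFPowerSeriesOnBall.iteratedFDeriv_eq_zero {n : ℕ} :
    ∀ {F : Type} [NormedAddCommGroup F] [NormedSpace ℝ F] {f : E → F}
      {q : FormalMultilinearSeries ℝ E F} {x : E},
      HasFiniteFPowerSeriesOnBall f q x n ⊤ → ∀ y, iteratedFDeriv ℝ n f y = 0 := by
  induction n with
  | zero =>
    intro F _ _ f q x h y
    ext v
    simpa using h.eq_zero_of_bound_zero y (by simp)
  | succ n ih =>
    intro F _ _ f q x h y
    rw [← norm_eq_zero, ← norm_iteratedFDeriv_fderiv, ih h.fderiv y, norm_zero]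

/-- A function whose derivatives of order less than `p` vanish at the origin, and whose `p`th
derivative is bounded by `M` on a ball, is small, together with its derivatives. -/
theorem norm_iteratedFDeriv_le_mul_pow {g : E → F} {p : ℕ} (hg : ContDiff ℝ p g)
    (h0 : ∀ i < p, iteratedFDeriv ℝ i g 0 = 0) {M ρ : ℝ}
    (hM : ∀ y, ‖y‖ ≤ ρ → ‖iteratedFDeriv ℝ p g y‖ ≤ M) :
    ∀ i j, i + j = p → ∀ y, ‖y‖ ≤ ρ → ‖iteratedFDeriv ℝ i g y‖ ≤ M * ‖y‖ ^ j := by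
  intro i j
  induction j generalizing i with
  | zero =>
    rintro rfl y hy
    simpa using hM y hy
  | succ j ih =>
    intro hij y hy
    have hM0 : 0 ≤ M := (norm_nonneg _).trans (hM y hy)
    have hd : Differentiable ℝ (iteratedFDeriv ℝ i g) :=
      hg.differentiable_iteratedFDeriv (by exact_mod_cast (by omega : i < p))
    have h := (convex_closedBall (0 : E) ‖y‖).norm_image_sub_le_of_norm_fderiv_le
      (f := iteratedFDeriv ℝ i g) (𝕜 := ℝ) (C := M * ‖y‖ ^ j) (x := 0) (y := y)
      (fun z _ => hd z) (fun z hz => by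
        rw [mem_closedBall_zero_iff] at hz
        rw [norm_fderiv_iteratedFDeriv]
        exact (ih (i + 1) (by omega) z (hz.trans hy)).trans (by gcongr))
      (by simp) (by simp)
    rw [h0 i (by omega), sub_zero, sub_zero] at h
    rw [pow_succ, ← mul_assoc]
    exact h

end Taylor

section ApproxTaylor

variable {n : ℕ}

/-- The coefficients of `approxTaylor`, as a formal multilinear series. -/
noncomputable def approxTaylorSeries (p : ℕ) (f : EuclideanSpace ℝ (Fin n) → ℝ) (x : EuclideanSpace ℝ (Fin n))
    (T : ContinuousMultilinearMap ℝ (fun _ : Fin p => EuclideanSpace ℝ (Fin n)) ℝ) :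
    FormalMultilinearSeries ℝ (EuclideanSpace ℝ (Fin n)) ℝ :=
  Function.update (fun i => if i < p then (1 / (i ! : ℝ)) • iteratedFDeriv ℝ i f x else 0) p
    ((1 / (p ! : ℝ)) • T)

variable {p : ℕ} (f : EuclideanSpace ℝ (Fin n) → ℝ) (x : EuclideanSpace ℝ (Fin n))
    (T : ContinuousMultilinearMap ℝ (fun _ : Fin p => EuclideanSpace ℝ (Fin n)) ℝ)

theorem approxTaylorSeries_self :
    approxTaylorSeries p f x T p = (1 / (p ! : ℝ)) • T := by
  simp [approxTaylorSeries]

theorem approxTaylorSeries_of_lt {i : ℕ} (hi : i < p) :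
    approxTaylorSeries p f x T i = (1 / (i ! : ℝ)) • iteratedFDeriv ℝ i f x := by
  simp [approxTaylorSeries, hi.ne, hi]

theorem hasFiniteFPowerSeriesOnBall_approxTaylor (hp : 1 ≤ p) :
    HasFiniteFPowerSeriesOnBall (approxTaylor p f x T) (approxTaylorSeries p f x T) 0 (p + 1) ⊤ := by
  apply HasFiniteFPowerSeriesOnBall.mk'
  · intro i hi
    have h1 : i ≠ p := by omega
    have h2 : ¬ i < p := by omega
    simp [approxTaylorSeries, h1, h2]
  · simp
  · intro y _
    rw [zero_add, Finset.sum_range_succ, approxTaylorSeries_self, approxTaylor,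
      Finset.sum_congr rfl fun i hi => by
        rw [approxTaylorSeries_of_lt f x T (Finset.mem_range.1 hi)],
      Finset.range_eq_Ico, Finset.sum_eq_sum_Ico_succ_bot (by omega : 0 < p),
      show Finset.Icc 1 (p - 1) = Finset.Ico (0 + 1) p by ext i; simp; omega]
    simp

theorem contDiff_approxTaylor (hp : 1 ≤ p) {k : WithTop ℕ∞} :
    ContDiff ℝ k (approxTaylor p f x T) := by
  have h := (hasFiniteFPowerSeriesOnBall_approxTaylor f x T hp).toHasFPowerSeriesOnBall.analyticOnNhd
  rw [contDiff_iff_contDiffAt]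
  exact fun y => (h y (by simp)).contDiffAt

/-- Differentiating a power series symmetrizes its coefficient over all `i !` permutations. For a
symmetric `A` the terms agree and cancel the factor `1 / i !`. -/
theorem iteratedFDeriv_approxTaylor_zero (hp : 1 ≤ p) {i : ℕ}
    (A : ContinuousMultilinearMap ℝ (fun _ : Fin i => EuclideanSpace ℝ (Fin n)) ℝ)
    (hA : ∀ (v : Fin i → EuclideanSpace ℝ (Fin n)) (σ : Equiv.Perm (Fin i)), A (v ∘ σ) = A v)
    (h : approxTaylorSeries p f x T i = (1 / (i ! : ℝ)) • A) :
    iteratedFDeriv ℝ i (approxTaylor p f x T) 0 = A := by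
  ext v
  rw [(hasFiniteFPowerSeriesOnBall_approxTaylor f x T
    hp).toHasFPowerSeriesOnBall.iteratedFDeriv_eq_sum_of_completeSpace v, h]
  have h1 : ∀ σ : Equiv.Perm (Fin i), ((1 / (i ! : ℝ)) • A) (fun j => v (σ j))
      = (1 / (i ! : ℝ)) * A v := fun σ => by
    rw [← hA v σ]; rfl
  simp only [h1, Finset.sum_const, Finset.card_univ, Fintype.card_perm, Fintype.card_fin,
    nsmul_eq_mul]
  have := Nat.factorial_ne_zero i
  field_simp

/-- Derivatives of the error of `approxTaylor`. -/
theorem norm_iteratedFDeriv_sub_approxTaylor_le (hp : 1 ≤ p) {L : ℝ} (hL : 0 ≤ L)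
    (hf : ContDiff ℝ p f)
    (hlip : ∀ y z, ‖iteratedFDeriv ℝ p f y - iteratedFDeriv ℝ p f z‖ ≤ L * ‖y - z‖)
    (hT : ∀ (v : Fin p → EuclideanSpace ℝ (Fin n)) (σ : Equiv.Perm (Fin p)), T (v ∘ σ) = T v)
    (s : EuclideanSpace ℝ (Fin n)) {i j : ℕ} (hij : i + j = p) :
    ‖iteratedFDeriv ℝ i f (x + s) - iteratedFDeriv ℝ i (approxTaylor p f x T) s‖
      ≤ (‖T - iteratedFDeriv ℝ p f x‖ + L * ‖s‖) * ‖s‖ ^ j := by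
  have hP : ContDiff ℝ p (approxTaylor p f x T) := contDiff_approxTaylor f x T hp
  have hfx : ContDiff ℝ p (fun z => f (x + z)) := hf.comp (contDiff_const.add contDiff_id)
  have hle : ∀ i ≤ p, (i : WithTop ℕ∞) ≤ p := fun i hi => by exact_mod_cast hi
  have hsub : ∀ i ≤ p, ∀ y, iteratedFDeriv ℝ i ((fun z => f (x + z)) - approxTaylor p f x T) y
      = iteratedFDeriv ℝ i f (x + y) - iteratedFDeriv ℝ i (approxTaylor p f x T) y := by
    intro i hi y
    rw [iteratedFDeriv_sub_apply (hfx.of_le (hle i hi)).contDiffAt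
      (hP.of_le (hle i hi)).contDiffAt, iteratedFDeriv_comp_add_left']
  have hconst : ∀ y, iteratedFDeriv ℝ p (approxTaylor p f x T) y = T := by
    intro y
    have hPs : ContDiff ℝ (p + 1 : ℕ) (approxTaylor p f x T) := contDiff_approxTaylor f x T hp
    have hd : Differentiable ℝ (iteratedFDeriv ℝ p (approxTaylor p f x T)) :=
      hPs.differentiable_iteratedFDeriv (by exact_mod_cast (by omega : p < p + 1))
    rw [is_const_of_fderiv_eq_zero hd (fun z => ?_) y 0]
    · exact iteratedFDeriv_approxTaylor_zero f x T hp T hT (approxTaylorSeries_self f x T)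
    · rw [← norm_eq_zero, norm_fderiv_iteratedFDeriv,
        (hasFiniteFPowerSeriesOnBall_approxTaylor f x T hp).iteratedFDeriv_eq_zero, norm_zero]
  -- The error has vanishing derivatives of order below `p` at the origin, and its `p`th derivative
  -- at `y` is `iteratedFDeriv ℝ p f (x + y) - T`.
  have h := norm_iteratedFDeriv_le_mul_pow (g := (fun z => f (x + z)) - approxTaylor p f x T)
    (p := p) (hfx.sub hP) (M := ‖T - iteratedFDeriv ℝ p f x‖ + L * ‖s‖) (ρ := ‖s‖) ?_ ?_ i j hij s
    le_rfl
  · rwa [hsub i (by omega)] at h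
  · intro i hi
    rw [hsub i hi.le, iteratedFDeriv_approxTaylor_zero f x T hp (iteratedFDeriv ℝ i f x)
      (fun v σ => (hf.of_le (hle i hi.le)).iteratedFDeriv_comp_perm x v σ)
      (approxTaylorSeries_of_lt f x T hi), add_zero, sub_self]
  · intro y hy
    rw [hsub p le_rfl, hconst]
    have h1 := hlip (x + y) x
    rw [add_sub_cancel_left] at h1
    calc ‖iteratedFDeriv ℝ p f (x + y) - T‖
        ≤ ‖iteratedFDeriv ℝ p f (x + y) - iteratedFDeriv ℝ p f x‖
          + ‖iteratedFDeriv ℝ p f x - T‖ := norm_sub_le_norm_sub_add_norm_sub _ _ _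
      _ ≤ L * ‖s‖ + ‖T - iteratedFDeriv ℝ p f x‖ := by
          rw [norm_sub_rev _ T]
          gcongr
          exact h1.trans (by gcongr)
      _ = _ := add_comm _ _

end ApproxTaylor

/-! ### Leftmost eigenvalues as bounds on quadratic forms. -/

section LeftmostEigenvalue

variable {n : ℕ}

/-- In dimension 0 the spectrum is empty and `sInf ∅ = 0`. -/
theorem lambdaMin_of_isEmpty (A : Matrix (Fin 0) (Fin 0) ℝ) : lambdaMin A = 0 := by
  simp [lambdaMin]

-- Shifting by `c` translates the spectrum; this links `lambdaMin` to the quadratic form without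
-- choosing eigenvectors.
open scoped Pointwise in
theorem posSemidef_sub_algebraMap_iff {A : Matrix (Fin n) (Fin n) ℝ} (hA : A.IsHermitian) (c : ℝ) :
    (A - algebraMap ℝ _ c).PosSemidef ↔ ∀ a ∈ spectrum ℝ A, c ≤ a := by
  have hH : (A - algebraMap ℝ (Matrix (Fin n) (Fin n) ℝ) c).IsHermitian := by
    apply hA.sub
    rw [Matrix.algebraMap_eq_diagonal]
    exact Matrix.isHermitian_diagonal _
  rw [Matrix.posSemidef_iff_isHermitian_and_spectrum_nonneg, ← spectrum.sub_singleton_eq]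
  constructor
  · rintro ⟨_, h⟩ a ha
    have : a - c ∈ spectrum ℝ A - {c} := Set.sub_mem_sub ha rfl
    simpa using h this
  · refine fun h => ⟨hH, ?_⟩
    rintro _ ⟨a, ha, b, rfl, rfl⟩
    simpa using h a ha

theorem dotProduct_sub_algebraMap_mulVec (A : Matrix (Fin n) (Fin n) ℝ) (c : ℝ) (v : Fin n → ℝ) :
    star v ⬝ᵥ ((A - algebraMap ℝ (Matrix (Fin n) (Fin n) ℝ) c).mulVec v)
      = v ⬝ᵥ A.mulVec v - c * (v ⬝ᵥ v) := by
  rw [Matrix.sub_mulVec, dotProduct_sub, Algebra.algebraMap_eq_smul_one, Matrix.smul_mulVec,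
    Matrix.one_mulVec, dotProduct_smul, star_trivial, smul_eq_mul]

theorem lambdaMin_mul_le_dotProduct {A : Matrix (Fin n) (Fin n) ℝ} (hA : A.IsHermitian)
    (v : Fin n → ℝ) : lambdaMin A * (v ⬝ᵥ v) ≤ v ⬝ᵥ A.mulVec v := by
  have h := (posSemidef_sub_algebraMap_iff hA (lambdaMin A)).2 fun a ha =>
    csInf_le (by rw [hA.spectrum_real_eq_range_eigenvalues]
                 exact (Set.finite_range _).bddBelow) ha
  have := h.dotProduct_mulVec_nonneg v
  rw [dotProduct_sub_algebraMap_mulVec] at this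
  linarith

theorem le_lambdaMin [NeZero n] {A : Matrix (Fin n) (Fin n) ℝ} (hA : A.IsHermitian) {c : ℝ}
    (h : ∀ v : Fin n → ℝ, c * (v ⬝ᵥ v) ≤ v ⬝ᵥ A.mulVec v) : c ≤ lambdaMin A := by
  apply le_csInf
  · rw [hA.spectrum_real_eq_range_eigenvalues]
    exact Set.range_nonempty _
  · refine (posSemidef_sub_algebraMap_iff hA c).1 (Matrix.PosSemidef.of_dotProduct_mulVec_nonneg ?_ ?_)
    · apply hA.sub
      rw [Matrix.algebraMap_eq_diagonal]
      exact Matrix.isHermitian_diagonal _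
    · intro v
      rw [dotProduct_sub_algebraMap_mulVec]
      linarith [h v]

theorem isHermitian_hessianMatrix {F : EuclideanSpace ℝ (Fin n) → ℝ} (hF : ContDiff ℝ 2 F)
    (x : EuclideanSpace ℝ (Fin n)) : (hessianMatrix F x).IsHermitian := by
  ext i j
  simp only [hessianMatrix, Matrix.conjTranspose_apply, Matrix.of_apply, star_trivial]
  rw [iteratedFDeriv_two_apply, iteratedFDeriv_two_apply]
  exact hF.contDiffAt.isSymmSndFDerivAt (by simp) _ _

theorem dotProduct_hessianMatrix_mulVec (F : EuclideanSpace ℝ (Fin n) → ℝ)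
    (x v : EuclideanSpace ℝ (Fin n)) :
    v.ofLp ⬝ᵥ (hessianMatrix F x).mulVec v.ofLp = iteratedFDeriv ℝ 2 F x (fun _ => v) := by
  rw [iteratedFDeriv_two_apply]
  have hv : v = ∑ i, v i • EuclideanSpace.single i (1 : ℝ) := by
    ext j; simp [Finset.sum_apply, Pi.single_apply]
  conv_rhs => rw [hv]
  simp only [map_sum, map_smul, sum_apply, smul_apply,
    dotProduct, Matrix.mulVec, hessianMatrix, Matrix.of_apply, iteratedFDeriv_two_apply,
    smul_eq_mul, Finset.mul_sum]
  rw [Finset.sum_comm]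
  refine Finset.sum_congr rfl fun i _ => Finset.sum_congr rfl fun j _ => ?_
  simp only [Matrix.cons_val_zero, Matrix.cons_val_one]
  ring

theorem dotProduct_self_eq_norm_sq (v : EuclideanSpace ℝ (Fin n)) :
    v.ofLp ⬝ᵥ v.ofLp = ‖v‖ ^ 2 := by
  rw [EuclideanSpace.real_norm_sq_eq, dotProduct]
  exact Finset.sum_congr rfl fun i _ => (sq _).symm

theorem lambdaMin_hessianMatrix_mul_le {F : EuclideanSpace ℝ (Fin n) → ℝ} (hF : ContDiff ℝ 2 F)
    (x v : EuclideanSpace ℝ (Fin n)) :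
    lambdaMin (hessianMatrix F x) * ‖v‖ ^ 2 ≤ iteratedFDeriv ℝ 2 F x (fun _ => v) := by
  rw [← dotProduct_hessianMatrix_mulVec, ← dotProduct_self_eq_norm_sq]
  exact lambdaMin_mul_le_dotProduct (isHermitian_hessianMatrix hF x) _

/-- Comparison of the leftmost eigenvalues of two Hessians. -/
theorem neg_lambdaMin_hessianMatrix_le {F P : EuclideanSpace ℝ (Fin n) → ℝ} (hF : ContDiff ℝ 2 F)
    (hP : ContDiff ℝ 2 P) (x y : EuclideanSpace ℝ (Fin n)) :
    -lambdaMin (hessianMatrix F x) ≤ max 0 (-lambdaMin (hessianMatrix P y))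
      + ‖iteratedFDeriv ℝ 2 F x - iteratedFDeriv ℝ 2 P y‖ := by
  rcases Nat.eq_zero_or_pos n with rfl | hn
  · rw [lambdaMin_of_isEmpty, lambdaMin_of_isEmpty]
    simp
  · have : NeZero n := ⟨hn.ne'⟩
    have h : lambdaMin (hessianMatrix P y) - ‖iteratedFDeriv ℝ 2 F x - iteratedFDeriv ℝ 2 P y‖
        ≤ lambdaMin (hessianMatrix F x) := by
      apply le_lambdaMin (isHermitian_hessianMatrix hF x)
      intro w
      obtain ⟨v, rfl⟩ : ∃ v : EuclideanSpace ℝ (Fin n), v.ofLp = w := ⟨WithLp.toLp 2 w, rfl⟩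
      rw [dotProduct_hessianMatrix_mulVec, dotProduct_self_eq_norm_sq, sub_mul]
      have h1 := lambdaMin_hessianMatrix_mul_le hP y v
      have h2 := (iteratedFDeriv ℝ 2 F x - iteratedFDeriv ℝ 2 P y).le_opNorm (fun _ => v)
      rw [sub_apply, Real.norm_eq_abs, Fin.prod_const] at h2
      have h3 := (abs_le.1 h2).1
      linarith
    have := le_max_right 0 (-lambdaMin (hessianMatrix P y))
    linarith

end LeftmostEigenvalue

/-! ### Gradients, homogeneous forms and evaluation counts. -/

section Auxiliary

variable {n : ℕ}

theorem norm_gradient_eq (F : EuclideanSpace ℝ (Fin n) → ℝ) (x : EuclideanSpace ℝ (Fin n)) :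
    ‖gradient F x‖ = ‖fderiv ℝ F x‖ := by
  rw [gradient, LinearIsometryEquiv.norm_map]

theorem neg_fderiv_apply_le (F : EuclideanSpace ℝ (Fin n) → ℝ) (x v : EuclideanSpace ℝ (Fin n)) :
    -fderiv ℝ F x v ≤ ‖gradient F x‖ * ‖v‖ := by
  rw [norm_gradient_eq]
  exact (neg_le_abs _).trans ((fderiv ℝ F x).le_opNorm v)

theorem norm_gradient_le_add (F P : EuclideanSpace ℝ (Fin n) → ℝ)
    (x y : EuclideanSpace ℝ (Fin n)) :
    ‖gradient F x‖ ≤ ‖gradient P y‖ + ‖iteratedFDeriv ℝ 1 F x - iteratedFDeriv ℝ 1 P y‖ := by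
  have h : ‖fderiv ℝ F x - fderiv ℝ P y‖
      ≤ ‖iteratedFDeriv ℝ 1 F x - iteratedFDeriv ℝ 1 P y‖ := by
    refine ContinuousLinearMap.opNorm_le_bound _ (norm_nonneg _) fun v => ?_
    simpa using (iteratedFDeriv ℝ 1 F x - iteratedFDeriv ℝ 1 P y).le_opNorm (fun _ => v)
  rw [norm_gradient_eq, norm_gradient_eq]
  have := norm_le_norm_add_norm_sub' (fderiv ℝ F x) (fderiv ℝ P y)
  linarith

theorem le_add_norm_iteratedFDeriv_zero_sub (F P : EuclideanSpace ℝ (Fin n) → ℝ)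
    (x y : EuclideanSpace ℝ (Fin n)) :
    F x ≤ P y + ‖iteratedFDeriv ℝ 0 F x - iteratedFDeriv ℝ 0 P y‖ := by
  have h := (iteratedFDeriv ℝ 0 F x - iteratedFDeriv ℝ 0 P y).le_opNorm 0
  simp only [sub_apply, iteratedFDeriv_zero_apply, Finset.univ_eq_empty, Finset.prod_empty,
    mul_one] at h
  have := le_abs_self (F x - P y)
  rw [Real.norm_eq_abs] at h
  linarith

theorem approxTaylor_zero {p : ℕ} (hp : 1 ≤ p) (f : EuclideanSpace ℝ (Fin n) → ℝ)
    (x : EuclideanSpace ℝ (Fin n))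
    (T : ContinuousMultilinearMap ℝ (fun _ : Fin p => EuclideanSpace ℝ (Fin n)) ℝ) :
    approxTaylor p f x T 0 = f x := by
  have h : ∀ i, 1 ≤ i → ∀ A : ContinuousMultilinearMap ℝ
      (fun _ : Fin i => EuclideanSpace ℝ (Fin n)) ℝ, A (fun _ => 0) = 0 :=
    fun i hi A => A.map_coord_zero ⟨0, hi⟩ rfl
  rw [approxTaylor, h p hp, Finset.sum_eq_zero]
  · simp
  · intro i hi
    rw [h i (Finset.mem_Icc.1 hi).1, mul_zero]

/-- A lower bound on the unit ball for a homogeneous form extends to the whole space. -/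
theorem neg_apply_diag_le {i : ℕ} {κ : ℝ}
    (A : ContinuousMultilinearMap ℝ (fun _ : Fin i => EuclideanSpace ℝ (Fin n)) ℝ)
    (h : ∀ d : EuclideanSpace ℝ (Fin n), ‖d‖ ≤ 1 → -κ ≤ A (fun _ => d))
    (s : EuclideanSpace ℝ (Fin n)) : -A (fun _ => s) ≤ κ * ‖s‖ ^ i := by
  have hs : s = ‖s‖ • (‖s‖⁻¹ • s) := by
    rcases eq_or_ne s 0 with rfl | h0
    · simp
    · rw [smul_smul, mul_inv_cancel₀ (norm_ne_zero_iff.2 h0), one_smul]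
  have hd : ‖‖s‖⁻¹ • s‖ ≤ 1 := by
    rw [norm_smul, norm_inv, norm_norm]
    exact inv_mul_le_one
  have h1 : A (fun _ => s) = ‖s‖ ^ i * A (fun _ => ‖s‖⁻¹ • s) := by
    conv_lhs => rw [hs]
    have := A.map_smul_univ (fun _ => ‖s‖) (fun _ => ‖s‖⁻¹ • s)
    simpa using this
  rw [h1]
  have := mul_le_mul_of_nonneg_left (h _ hd) (by positivity : 0 ≤ ‖s‖ ^ i)
  linarith

theorem neg_apply_diag_le_norm {i : ℕ}
    (A : ContinuousMultilinearMap ℝ (fun _ : Fin i => EuclideanSpace ℝ (Fin n)) ℝ)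
    (s : EuclideanSpace ℝ (Fin n)) : -A (fun _ => s) ≤ ‖A‖ * ‖s‖ ^ i := by
  have := A.le_opNorm (fun _ => s)
  rw [Fin.prod_const] at this
  exact (neg_le_abs _).trans this

theorem neg_one_div_factorial_mul_le (i : ℕ) {y Y : ℝ} (hY : 0 ≤ Y) (h : -y ≤ Y) :
    -(1 / (i ! : ℝ) * y) ≤ Y := by
  have h1 : (1 : ℝ) ≤ i ! := by exact_mod_cast Nat.factorial_pos i
  have h0 : (0 : ℝ) ≤ 1 / i ! := by positivity
  have h2 : 1 / (i ! : ℝ) ≤ 1 := by rw [div_le_one (by linarith)]; exact h1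
  calc -(1 / (i ! : ℝ) * y) = 1 / (i ! : ℝ) * (-y) := by ring
    _ ≤ 1 / (i ! : ℝ) * Y := by gcongr
    _ ≤ 1 * Y := by gcongr
    _ = Y := one_mul _

theorem card_lazyEvaluations_le (p m K : ℕ) : (lazyEvaluations p m K).card ≤ p * K := by
  refine (Finset.card_filter_le _ _).trans ?_
  simp

end Auxiliary

/-! ### Estimates along a run of the algorithm. -/

namespace IsARpLazyRun

variable {n p m : ℕ} {θ₁ θ₂ σ₀ : ℝ} {f : EuclideanSpace ℝ (Fin n) → ℝ}
  {x₀ : EuclideanSpace ℝ (Fin n)} {x s : ℕ → EuclideanSpace ℝ (Fin n)} {σ : ℕ → ℝ}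
  {T : ℕ → ContinuousMultilinearMap ℝ (fun _ : Fin p => EuclideanSpace ℝ (Fin n)) ℝ}

theorem tensor_eq (h : IsARpLazyRun p m θ₁ θ₂ σ₀ f x₀ x s σ T) (k : ℕ) :
    T k = iteratedFDeriv ℝ p f (x (m * (k / m))) := by
  induction k with
  | zero => simpa using h.tensor_refresh 0 (Nat.zero_mod m)
  | succ k ih =>
    by_cases hk : (k + 1) % m = 0
    · rw [h.tensor_refresh _ hk, Nat.mul_div_cancel' (Nat.dvd_of_mod_eq_zero hk)]
    · rw [h.tensor_keep k hk, ih, Nat.succ_div_of_not_dvd fun hd => hk (Nat.mod_eq_zero_of_dvd hd)]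

theorem sigma_pos (h : IsARpLazyRun p m θ₁ θ₂ σ₀ f x₀ x s σ T) (hσ₀ : 0 < σ₀) (k : ℕ) :
    0 < σ k := by
  induction k with
  | zero => rwa [h.sigma_zero]
  | succ k ih => rw [h.sigma_succ]; positivity

/-- The error of the lazy tensor is controlled by the steps made since it was computed. -/
theorem norm_tensor_sub_le (h : IsARpLazyRun p m θ₁ θ₂ σ₀ f x₀ x s σ T) (hm : 1 ≤ m) {L : ℝ}
    (hL : 0 ≤ L)
    (hlip : ∀ y z, ‖iteratedFDeriv ℝ p f y - iteratedFDeriv ℝ p f z‖ ≤ L * ‖y - z‖) (k : ℕ) :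
    ‖T k - iteratedFDeriv ℝ p f (x k)‖ ≤ L * ∑ i ∈ Finset.Ico (k + 1 - m) k, ‖s i‖ := by
  rw [h.tensor_eq]
  refine (hlip _ _).trans (mul_le_mul_of_nonneg_left ?_ hL)
  rw [← dist_eq_norm]
  refine (dist_le_Ico_sum_dist x (Nat.mul_div_le k m)).trans ?_
  have h1 : ∀ i, dist (x i) (x (i + 1)) = ‖s i‖ := fun i => by
    rw [h.x_succ, dist_self_add_right]
  simp only [h1]
  apply Finset.sum_le_sum_of_subset_of_nonneg
  -- The last refresh index `m * (k / m)` is at least `k + 1 - m`.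
  · apply Finset.Ico_subset_Ico_left
    have h2 := Nat.div_add_mod k m
    have h3 := Nat.mod_lt k (by omega : m > 0)
    omega
  · exact fun i _ _ => norm_nonneg _

theorem norm_iteratedFDeriv_sub_le (h : IsARpLazyRun p m θ₁ θ₂ σ₀ f x₀ x s σ T) (hp : 1 ≤ p)
    (hm : 1 ≤ m) {L : ℝ} (hL : 0 ≤ L) (hf : ContDiff ℝ p f)
    (hlip : ∀ y z, ‖iteratedFDeriv ℝ p f y - iteratedFDeriv ℝ p f z‖ ≤ L * ‖y - z‖) (k : ℕ)
    {i j : ℕ} (hij : i + j = p) :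
    ‖iteratedFDeriv ℝ i f (x (k + 1)) - iteratedFDeriv ℝ i (approxTaylor p f (x k) (T k)) (s k)‖
      ≤ L * (∑ i ∈ Finset.Ico (k + 1 - m) (k + 1), ‖s i‖) * ‖s k‖ ^ j := by
  rw [h.x_succ]
  refine (norm_iteratedFDeriv_sub_approxTaylor_le f (x k) (T k) hp hL hf hlip ?_ (s k) hij).trans ?_
  · intro v τ
    rw [h.tensor_eq]
    exact hf.iteratedFDeriv_comp_perm _ v τ
  · apply mul_le_mul_of_nonneg_right _ (by positivity)
    -- The current step joins the window: its term `L * ‖s k‖` is the Lipschitz part of the Taylor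
    -- error.
    rw [Finset.sum_Ico_succ_top (by omega), mul_add]
    exact add_le_add_left (h.norm_tensor_sub_le hm hL hlip k) _

theorem apply_le (h : IsARpLazyRun p m θ₁ θ₂ σ₀ f x₀ x s σ T) (hp : 1 ≤ p) (k : ℕ) :
    σ k / ((p + 1)! : ℝ) * ‖s k‖ ^ (p + 1) ≤ f (x k) - approxTaylor p f (x k) (T k) (s k) := by
  have h1 := h.model_decrease k
  rw [regModel, regModel, approxTaylor_zero hp, norm_zero, zero_pow (by omega), mul_zero] at h1
  linarith

/-- The model cannot decrease along steps that are long compared with the derivatives. -/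
theorem step_le (h : IsARpLazyRun p m θ₁ θ₂ σ₀ f x₀ x s σ T) (hp : 2 ≤ p)
    (hm : 1 ≤ m) {L κhigh κp : ℝ} (hL : 0 ≤ L) (hκ : 0 ≤ κhigh) (hf : ContDiff ℝ p f)
    (hlip : ∀ y z, ‖iteratedFDeriv ℝ p f y - iteratedFDeriv ℝ p f z‖ ≤ L * ‖y - z‖)
    (hhigh : ∀ y, ∀ i ∈ Finset.Icc 3 (p - 1), ∀ d : EuclideanSpace ℝ (Fin n), ‖d‖ ≤ 1 →
      -κhigh ≤ iteratedFDeriv ℝ i f y (fun _ => d))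
    (hκp : 3 ≤ p → ∀ y, ‖iteratedFDeriv ℝ p f y‖ ≤ κp) (k : ℕ) :
    σ k / ((p + 1)! : ℝ) * ‖s k‖ ^ (p + 1) ≤
      (max ‖gradient f (x k)‖ 0 + max (-lambdaMin (hessianMatrix f (x k))) 0 + (κhigh + |κp|)
        + L * ∑ i ∈ Finset.Ico (k + 1 - m) k, ‖s i‖) * ∑ i ∈ Finset.Icc 1 p, ‖s k‖ ^ i := by
  have hw : 0 ≤ L * ∑ i ∈ Finset.Ico (k + 1 - m) k, ‖s i‖ :=
    mul_nonneg hL (Finset.sum_nonneg fun i _ => norm_nonneg _)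
  have hT := h.norm_tensor_sub_le hm hL hlip k
  set W := L * ∑ i ∈ Finset.Ico (k + 1 - m) k, ‖s i‖
  have hG : 0 ≤ max ‖gradient f (x k)‖ 0 := le_max_right _ _
  have hB : 0 ≤ max (-lambdaMin (hessianMatrix f (x k))) 0 := le_max_right _ _
  have hκp0 := abs_nonneg κp
  have hf2 : ContDiff ℝ 2 f := hf.of_le (by exact_mod_cast hp)
  have hcurv : -iteratedFDeriv ℝ 2 f (x k) (fun _ => s k)
      ≤ max (-lambdaMin (hessianMatrix f (x k))) 0 * ‖s k‖ ^ 2 := by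
    have h1 := lambdaMin_hessianMatrix_mul_le hf2 (x k) (s k)
    have h2 := mul_le_mul_of_nonneg_right (le_max_left (-lambdaMin (hessianMatrix f (x k))) 0)
      (sq_nonneg ‖s k‖)
    linarith
  set A := max ‖gradient f (x k)‖ 0 + max (-lambdaMin (hessianMatrix f (x k))) 0
    + (κhigh + |κp|) + W with hA
  have hA0 : 0 ≤ A := by positivity
  have hlow : ∀ i ∈ Finset.Icc 1 (p - 1),
      -(1 / (i ! : ℝ) * iteratedFDeriv ℝ i f (x k) (fun _ => s k)) ≤ A * ‖s k‖ ^ i := by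
    intro i hi
    rw [Finset.mem_Icc] at hi
    apply neg_one_div_factorial_mul_le _ (by positivity)
    rcases (by omega : i = 1 ∨ i = 2 ∨ 3 ≤ i) with rfl | rfl | h3
    · rw [iteratedFDeriv_one_apply, pow_one]
      refine (neg_fderiv_apply_le f (x k) (s k)).trans ?_
      gcongr
      linarith [le_max_left ‖gradient f (x k)‖ 0]
    · refine hcurv.trans ?_
      gcongr
      linarith
    · refine (neg_apply_diag_le _ (hhigh (x k) i (Finset.mem_Icc.2 ⟨h3, hi.2⟩)) (s k)).trans ?_
      gcongr
      linarith
  have htop : -(1 / (p ! : ℝ) * T k (fun _ => s k)) ≤ A * ‖s k‖ ^ p := by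
    apply neg_one_div_factorial_mul_le _ (by positivity)
    -- For `p = 2` no bound on the Hessian's norm is assumed, so the form of `T k` is bounded below
    -- by the current curvature plus the tensor error. For `p ≥ 3`, `κp` bounds `T k`, a derivative
    -- at an earlier or current iterate.
    rcases (by omega : p = 2 ∨ 3 ≤ p) with rfl | h3
    · have h1 := neg_apply_diag_le_norm (T k - iteratedFDeriv ℝ 2 f (x k)) (s k)
      rw [sub_apply] at h1
      have h2 : ‖T k - iteratedFDeriv ℝ 2 f (x k)‖ * ‖s k‖ ^ 2 ≤ W * ‖s k‖ ^ 2 := by gcongr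
      have h3 : (max (-lambdaMin (hessianMatrix f (x k))) 0 + W) * ‖s k‖ ^ 2
          ≤ A * ‖s k‖ ^ 2 := by
        gcongr
        linarith
      linarith
    · refine (neg_apply_diag_le_norm (T k) (s k)).trans ?_
      gcongr
      rw [h.tensor_eq]
      linarith [hκp h3 (x (m * (k / m))), le_abs_self κp]
  refine (h.apply_le (by omega) k).trans ?_
  have hsum : ∑ i ∈ Finset.Icc 1 p, ‖s k‖ ^ i
      = ∑ i ∈ Finset.Icc 1 (p - 1), ‖s k‖ ^ i + ‖s k‖ ^ p := by
    have := Finset.sum_Icc_succ_top (a := 1) (b := p - 1) (by omega) (fun i => ‖s k‖ ^ i)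
    rwa [Nat.sub_add_cancel (by omega)] at this
  rw [hsum, mul_add, Finset.mul_sum, approxTaylor]
  have := Finset.sum_le_sum hlow
  rw [Finset.sum_neg_distrib] at this
  linarith

end IsARpLazyRun

/-! ### From the abstract bound to the algorithm. -/

theorem mainTheorem4
    (p m : ℕ) (hp : 2 ≤ p) (hm : 1 ≤ m)
    (θ₁ θ₂ σ₀ : ℝ) (hθ₁ : 1 < θ₁) (hθ₂ : 1 < θ₂) (hσ₀ : 0 < σ₀)
    (L κhigh κp : ℝ) (hL : 3 ≤ L) (hκhigh : 0 ≤ κhigh)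
    (Δ G₀ B₀ : ℝ) :
    ∃ C : ℝ, 0 < C ∧
      ∀ (n : ℕ) (f : EuclideanSpace ℝ (Fin n) → ℝ) (flow : ℝ)
        (x₀ : EuclideanSpace ℝ (Fin n)),
        ContDiff ℝ p f →
        (∀ y, flow ≤ f y) →
        (∀ y z, ‖iteratedFDeriv ℝ p f y - iteratedFDeriv ℝ p f z‖ ≤ L * ‖y - z‖) →
        (∀ y, ∀ i ∈ Finset.Icc 3 (p - 1), ∀ d : EuclideanSpace ℝ (Fin n), ‖d‖ ≤ 1 →
          -κhigh ≤ iteratedFDeriv ℝ i f y (fun _ => d)) →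
        (3 ≤ p → ∀ y, ‖iteratedFDeriv ℝ p f y‖ ≤ κp) →
        f x₀ - flow ≤ Δ →
        ‖gradient f x₀‖ ≤ G₀ →
        -lambdaMin (hessianMatrix f x₀) ≤ B₀ →
        ∀ (x s : ℕ → EuclideanSpace ℝ (Fin n)) (σ : ℕ → ℝ)
          (T : ℕ → ContinuousMultilinearMap ℝ (fun _ : Fin p => EuclideanSpace ℝ (Fin n)) ℝ),
          IsARpLazyRun p m θ₁ θ₂ σ₀ f x₀ x s σ T →
          ∀ ε₁ ε₂ : ℝ, 0 < ε₁ → 0 < ε₂ →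
            ∃ k : ℕ,
              ‖gradient f (x k)‖ ≤ ε₁ ∧
              -ε₂ ≤ lambdaMin (hessianMatrix f (x k)) ∧
              (k : ℝ) ≤ C * max (ε₁ ^ (-(((p : ℝ) + 1) / p)))
                (ε₂ ^ (-(((p : ℝ) + 1) / ((p : ℝ) - 1)))) ∧
              ((lazyEvaluations p m k).card : ℝ) ≤
                C * max (ε₁ ^ (-(((p : ℝ) + 1) / p)))
                  (ε₂ ^ (-(((p : ℝ) + 1) / ((p : ℝ) - 1)))) := by
  have hL0 : 0 < L := by linarith
  have hp1 : (1 : ℝ) ≤ p := by exact_mod_cast (by omega : 1 ≤ p)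
  obtain ⟨C, hC, hbound⟩ := exists_iteration_bound p m hp hm (max θ₁ θ₂) σ₀ L (κhigh + |κp|)
    ((p + 1)! : ℝ) Δ G₀ B₀ (le_max_of_le_left (by linarith)) hσ₀ hL0 (by positivity) (by positivity)
  -- The factor `p` covers the at most `p` derivative evaluations per iteration.
  refine ⟨p * C, by positivity, ?_⟩
  intro n f flow x₀ hf hlow hlip hhigh hκp hΔ hG₀ hB₀ x s σ T h ε₁ ε₂ hε₁ hε₂
  have hf2 : ContDiff ℝ 2 f := hf.of_le (by exact_mod_cast hp)
  have hfact : ∀ i : ℕ, (1 : ℝ) ≤ i ! := fun i => by exact_mod_cast Nat.factorial_pos i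
  have hσ := h.sigma_pos hσ₀
  have herr := fun k i j hij =>
    h.norm_iteratedFDeriv_sub_le (by omega) hm hL0.le hf hlip k (i := i) (j := j) hij
  have htest : ∀ (k i j : ℕ) (θ : ℝ), 1 < θ → θ ≤ max θ₁ θ₂ →
      θ * σ k * ‖s k‖ ^ i / (j ! : ℝ) ≤ max θ₁ θ₂ * σ k * ‖s k‖ ^ i := by
    intro k i j θ hθ1 hθ
    have := hσ k
    have hθ0 : 0 < θ := by linarith
    refine (div_le_self (by positivity) (hfact j)).trans ?_
    gcongr
  obtain ⟨k, hGk, hBk, hk⟩ := hbound (fun k => ‖s k‖) σ (fun k => f (x k))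
    (fun k => ‖gradient f (x k)‖) (fun k => -lambdaMin (hessianMatrix f (x k))) flow
    (fun k => norm_nonneg _) h.sigma_zero h.sigma_succ (fun k => hlow _)
    (by rwa [h.x_zero]) (by rwa [h.x_zero]) (by rwa [h.x_zero])
    (fun k => by
      have h1 := le_add_norm_iteratedFDeriv_zero_sub f (approxTaylor p f (x k) (T k)) (x (k + 1))
        (s k)
      have h2 := herr k 0 p (zero_add p)
      have h3 := h.apply_le (by omega) k
      linarith)
    (fun k => (norm_gradient_le_add f (approxTaylor p f (x k) (T k)) _ (s k)).trans
      (add_le_add ((h.gradient_test k).trans (htest k _ _ _ hθ₁ (le_max_left _ _)))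
        (herr k 1 (p - 1) (by omega))))
    (fun k => (neg_lambdaMin_hessianMatrix_le hf2 (contDiff_approxTaylor f (x k) (T k) (by omega))
      _ (s k)).trans
      (add_le_add ((h.curvature_test k).trans (htest k _ _ _ hθ₂ (le_max_right _ _)))
        (herr k 2 (p - 2) (by omega))))
    (fun k => h.step_le hp hm hL0.le hκhigh hf hlip hhigh hκp k) ε₁ ε₂ hε₁ hε₂
  refine ⟨k, hGk, neg_le.1 hBk, ?_, ?_⟩
  · refine hk.trans ?_
    rw [mul_assoc]
    exact le_mul_of_one_le_left (k.cast_nonneg.trans hk) hp1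
  · calc ((lazyEvaluations p m k).card : ℝ) ≤ p * k := by
          exact_mod_cast card_lazyEvaluations_le p m k
      _ ≤ _ := by
          rw [mul_assoc]
          gcongr
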